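/- **Conventions.** For a real linear subspace $W\subseteq\mathbb{R}^n$, regard its complexification as a real projective linear space $\mathbb{P}(W_{\mathbb{C}})\subseteq\mathbb{P}^{n-1}(\mathbb{C})$ of projective dimension $\dim W-1$. A point of $\mathbb{P}^{n-1}(\mathbb{C})$ is *real* if it has real homogeneous coordinates. A real quasi-projective variety $X\subseteq\mathbb{P}^{n-1}(\mathbb{C})$ of codimension $c$ is *hyperbolic* with respect to a real linear subspace $W\subseteq\mathbb{R}^n$ of dimension $c$ if $X\cap\mathbb{P}(W_{\mathbb{C}})=\emptyset$ and, for every real linear subspace $W'\supseteq W$ of dimension $c+1$, all points of $X\cap\mathbb{P}(W'_{\mathbb{C}})$ are real. Let $\mathrm{Gr}(c,n)$ be the Grassmannian of $c$-dimensional subspaces of $\mathbb{R}^n$, with its Euclidean topology and Plücker coordinates $p_I$, $I\in\binom{[n]}{c}$. For $\sigma\in\{\pm1\}^{\binom{n}{c}}$ let $\mathrm{Gr}(c,n)^\sigma$ be the set of $M\in\mathrm{Gr}(c,n)$ for which the products $\sigma_I\,p_I(M)$ are either all strictly positive or all strictly negative. A real quasi-projective variety $X$ of codimension $c$ is *$\sigma$-stable*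 if it is hyperbolic with respect to every $M\in\mathrm{Gr}(c,n)^\sigma$. **Statement.** Let $\mathcal{L}\subseteq\mathbb{R}^n$ be a $d$-dimensional linear subspace not contained in any coordinate hyperplane $\{x_i=0\}$, let $\mathcal{L}^\perp\subseteq\mathbb{R}^n$ be its orthogonal complement, and let $$\mathcal{L}^{-1}=\overline{\{[x_1^{-1}:\cdots:x_n^{-1}]\;:\;x\in\mathcal{L}_{\mathbb{C}}\cap(\mathbb{C}^*)^n\}}\subseteq\mathbb{P}^{n-1}(\mathbb{C})$$ (Zariski closure) be its reciprocal linear space, where $\mathcal{L}_{\mathbb{C}}\subseteq\mathbb{C}^n$ is the complexification of $\mathcal{L}$. Then $\mathcal{L}^{-1}$ is a real variety of codimension $n-d$ that is hyperbolic with respect to $\mathcal{L}^\perp$. Moreover, for every $\sigma\in\{\pm1\}^{\binom{n}{n-d}}$ such that $\mathcal{L}^\perp$ lies in the Euclidean closure of $\mathrm{Gr}(n-d,n)^\sigma$, the variety $\mathcal{L}^{-1}$ is $\sigma$-stable. -/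

import Mathlib

open scoped LinearAlgebra.Projectivization

namespace ReciprocalLinear

noncomputable section

/-! ### Real linear spaces and the complex projective space `ℙ^{n-1}(ℂ)` -/

/-- The complexification in `ℂⁿ` of a real linear subspace `W ⊆ ℝⁿ`, that is, its complex span.
These are exactly the complex linear subspaces of `ℂⁿ` defined over the reals. -/
def complexify {n : ℕ} (W : Submodule ℝ (EuclideanSpace ℝ (Fin n))) :
    Submodule ℂ (Fin n → ℂ) :=
  Submodule.span ℂ ((fun (w : EuclideanSpace ℝ (Fin n)) (i : Fin n) => (w i : ℂ)) ''
    (W : Set (EuclideanSpace ℝ (Fin n))))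

/-- The real projective linear space in `ℙ^{n-1}(ℂ)` given by a real linear subspace `W ⊆ ℝⁿ`;
its projective dimension is `dim W - 1`. -/
def projLinear {n : ℕ} (W : Submodule ℝ (EuclideanSpace ℝ (Fin n))) :
    Set (ℙ ℂ (Fin n → ℂ)) :=
  {p | p.rep ∈ complexify W}

/-- A point of `ℙ^{n-1}(ℂ)` is real if it has real homogeneous coordinates. -/
def IsRealPoint {n : ℕ} (p : ℙ ℂ (Fin n → ℂ)) : Prop :=
  ∃ (v : Fin n → ℝ) (hv : (fun i => (v i : ℂ)) ≠ 0), p = Projectivization.mk ℂ _ hv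

/-! ### Zariski topology, dimension, real varieties -/

/-- The Zariski closure of a subset `S` of `ℙ^{n-1}(ℂ)`: the set of common zeros of all homogeneous
polynomials that vanish on `S`. -/
def zariskiClosure {n : ℕ} (S : Set (ℙ ℂ (Fin n → ℂ))) : Set (ℙ ℂ (Fin n → ℂ)) :=
  {p | ∀ (k : ℕ) (f : MvPolynomial (Fin n) ℂ), f.IsHomogeneous k →
    (∀ q ∈ S, MvPolynomial.eval q.rep f = 0) → MvPolynomial.eval p.rep f = 0}

/-- A subset of `ℙ^{n-1}(ℂ)` is quasi-projective if it is the difference of two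
Zariski closed subsets. -/
def IsQuasiProjective {n : ℕ} (X : Set (ℙ ℂ (Fin n → ℂ))) : Prop :=
  ∃ Y Z : Set (ℙ ℂ (Fin n → ℂ)),
    zariskiClosure Y = Y ∧ zariskiClosure Z = Z ∧ X = Y \ Z

/-- The affine cone over `X`, including the origin. -/
def affineCone {n : ℕ} (X : Set (ℙ ℂ (Fin n → ℂ))) : Set (Fin n → ℂ) :=
  {v | ∀ hv : v ≠ 0, Projectivization.mk ℂ v hv ∈ X}

/-- The homogeneous coordinate ring of `X` (equivalently, of its Zariski closure). -/
abbrev CoordinateRing {n : ℕ} (X : Set (ℙ ℂ (Fin n → ℂ))) : Type :=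
  MvPolynomial (Fin n) ℂ ⧸ MvPolynomial.vanishingIdeal ℂ (affineCone X)

/-- `X ⊆ ℙ^{n-1}(ℂ)` has codimension `c`, that is, dimension `n - 1 - c`. The Krull dimension of the
homogeneous coordinate ring is the dimension of the affine cone, `dim X + 1`. -/
def HasCodim {n : ℕ} (X : Set (ℙ ℂ (Fin n → ℂ))) (c : ℕ) : Prop :=
  ringKrullDim (CoordinateRing X) + (c : WithBot ℕ∞) = (n : WithBot ℕ∞)

/-- A real quasi-projective variety of codimension `c` in `ℙ^{n-1}(ℂ)`. It is not required to be
irreducible. For a quasi-projective set, being defined over `ℝ` means being invariant under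
complex conjugation. -/
structure IsRealVariety {n : ℕ} (X : Set (ℙ ℂ (Fin n → ℂ))) (c : ℕ) : Prop where
  quasiProjective : IsQuasiProjective X
  conj_mem : ∀ v ∈ affineCone X, (fun i => (starRingEnd ℂ) (v i)) ∈ affineCone X
  codim : HasCodim X c

/-! ### Hyperbolicity -/

/-- `X` is a real quasi-projective variety which is hyperbolic with respect to the real projective
linear space given by `W ⊆ ℝⁿ`: the codimension `c` of `X` is `dim W` (so the projective
dimension of the linear space is `c - 1`), `X` does not meet it, and every real projective linear
space of projective dimension `c` containing it meets `X` in real points only. -/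
structure IsHyperbolic {n : ℕ} (X : Set (ℙ ℂ (Fin n → ℂ)))
    (W : Submodule ℝ (EuclideanSpace ℝ (Fin n))) : Prop where
  variety : IsRealVariety X (Module.finrank ℝ W)
  inter_eq_empty : X ∩ projLinear W = ∅
  real_points : ∀ W' : Submodule ℝ (EuclideanSpace ℝ (Fin n)), W ≤ W' →
    Module.finrank ℝ W' = Module.finrank ℝ W + 1 → ∀ p ∈ X ∩ projLinear W', IsRealPoint p

/-! ### The real Grassmannian, its Euclidean topology and its orthants -/

/-- The real Grassmannian `Gr(c, n)`: the `c`-dimensional linear subspaces of `ℝⁿ`. -/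
@[ext]
structure Grassmannian (c n : ℕ) where
  space : Submodule ℝ (EuclideanSpace ℝ (Fin n))
  finrank_eq : Module.finrank ℝ space = c

/-- Linearly independent `c`-tuples of vectors in `ℝⁿ`. -/
abbrev Frame (c n : ℕ) : Type :=
  {v : Fin c → EuclideanSpace ℝ (Fin n) // LinearIndependent ℝ v}

/-- The point of the Grassmannian spanned by a frame. -/
def Frame.toGrassmannian {c n : ℕ} (v : Frame c n) : Grassmannian c n where
  space := Submodule.span ℝ (Set.range v.1)
  finrank_eq := by simpa using finrank_span_eq_card v.2

/-- The Euclidean topology on the Grassmannian, as the quotient of the space of frames. -/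
instance (c n : ℕ) : TopologicalSpace (Grassmannian c n) :=
  TopologicalSpace.coinduced Frame.toGrassmannian inferInstance

/-- The `c`-element subsets of `[n]`, which index the Plücker coordinates. -/
abbrev Subsets (c n : ℕ) : Type := {I : Finset (Fin n) // I.card = c}

/-- The Plücker coordinate `p_I` of the span of a frame: the coefficient of `e_I` in
`v_1 ∧ ⋯ ∧ v_c`, that is, the minor of the matrix with rows `v_1, …, v_c` on the columns in `I`,
taken in increasing order. -/
def plucker {c n : ℕ} (v : Frame c n) (I : Subsets c n) : ℝ :=
  (Matrix.of fun i j : Fin c => v.1 i (I.1.orderEmbOfFin I.2 j)).det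

/-- The orthant `Gr(c, n)^σ`: the subspaces `M` for which the products `σ_I p_I(M)` are all strictly
positive or all strictly negative. Plücker coordinates are defined up to a common nonzero
factor, so the choice of the frame spanning `M` does not matter. -/
def orthant {c n : ℕ} (σ : Subsets c n → ℤˣ) : Set (Grassmannian c n) :=
  {M | ∃ v : Frame c n, v.toGrassmannian = M ∧
    ((∀ I, 0 < ((σ I : ℤ) : ℝ) * plucker v I) ∨ (∀ I, ((σ I : ℤ) : ℝ) * plucker v I < 0))}

/-- A real quasi-projective variety `X` of codimension `c` is `σ`-stable if it is hyperbolic with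
respect to every `M ∈ Gr(c, n)^σ`. -/
structure IsStable {n c : ℕ} (X : Set (ℙ ℂ (Fin n → ℂ))) (σ : Subsets c n → ℤˣ) : Prop where
  variety : IsRealVariety X c
  hyperbolic : ∀ M ∈ orthant σ, IsHyperbolic X M.space

/-- The orthogonal complement, as a map `Gr(d, n) → Gr(n - d, n)`. -/
def Grassmannian.perp {d n : ℕ} (L : Grassmannian d n) : Grassmannian (n - d) n where
  space := L.spaceᗮ
  finrank_eq := by
    have h := L.space.finrank_add_finrank_orthogonal
    rw [L.finrank_eq, finrank_euclideanSpace_fin] at h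
    omega

/-! ### Reciprocal linear spaces -/

/-- The reciprocal linear space of the complexification of `L ⊆ ℝⁿ`: the Zariski closure in
`ℙ^{n-1}(ℂ)` of the points `[x_1⁻¹ : ⋯ : x_n⁻¹]`, where `x` runs over the vectors of the
complexification all of whose coordinates are nonzero. -/
def reciprocal {n : ℕ} (L : Submodule ℝ (EuclideanSpace ℝ (Fin n))) :
    Set (ℙ ℂ (Fin n → ℂ)) :=
  zariskiClosure {p | ∃ x ∈ complexify L, (∀ i, x i ≠ 0) ∧
    ∃ h : (fun i => (x i)⁻¹) ≠ 0, p = Projectivization.mk ℂ (fun i => (x i)⁻¹) h}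

end

end ReciprocalLinear

/-! # Hyperbolicity of reciprocal linear spaces

The circuit polynomials `∑ a_i ∏_{j ≠ i} y_j`, one for every linear relation `∑ a_i x_i = 0` on `L`,
vanish on `L⁻¹`. They show that every `p ∈ L⁻¹`, also on the boundary, satisfies `x_i p_i = 1` on its
support for some `x ∈ L_ℂ` (`exists_inv_mem_complexify`). Hence `p_i = |p_i|² x̄_i` on the support, and
the real and imaginary parts of `p` agree in sign with vectors of `L`, wherever they are nonzero.
Call `M` and `L` sign-transversal if no nonzero vector of `M` has this property. Then `L⁻¹` does not
meet `M_ℂ`; and a point of `L⁻¹` in the span of `M_ℂ` and a real vector `v` can be scaled to have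
imaginary part in `M`, so it is real (`SignTransversal.isHyperbolic`).

For `M = Lᗮ` sign-transversality is immediate, because `∑ x_i p_i = 0` cannot be a sum of positive
terms. For `M` in an orthant whose closure contains `Lᗮ`, the Plücker coordinates of `M` are nonzero
and agree weakly in sign with those of `Lᗮ`. By the Cauchy–Binet formula
`∑ p_I(M) δ_I p_I(Lᗮ) ≠ 0` for every positive diagonal matrix `δ`, so that `δ M` and `L` meet only
in the origin. As no Plücker coordinate of `M` vanishes, a violation of sign-transversality can be
perturbed to a nonzero common vector of some `δ M` and `L` (`signTransversal_of_plucker`).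

For the codimension, the coordinate ring of `L⁻¹` is the subalgebra generated by the inverses of `n`
linear forms spanning the linear forms in `d` variables. It has transcendence degree `d`, which is
its Krull dimension by Noether normalization. -/

open scoped LinearAlgebra.Projectivization

namespace ReciprocalLinear

/-! ### Complexification -/

theorem mem_complexify {n : ℕ} {W : Submodule ℝ (EuclideanSpace ℝ (Fin n))} {x : Fin n → ℂ} :
    x ∈ complexify W ↔ WithLp.toLp 2 (fun i => (x i).re) ∈ W ∧
      WithLp.toLp 2 (fun i => (x i).im) ∈ W := by
  constructor
  · intro hx
    induction hx using Submodule.span_induction with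
    | mem x h =>
      obtain ⟨w, hw, rfl⟩ := h
      exact ⟨hw, W.zero_mem⟩
    | zero => exact ⟨W.zero_mem, W.zero_mem⟩
    | add x y _ _ hx hy => exact ⟨W.add_mem hx.1 hy.1, W.add_mem hx.2 hy.2⟩
    | smul a x _ hx =>
      constructor
      · convert W.sub_mem (W.smul_mem a.re hx.1) (W.smul_mem a.im hx.2) using 1
        ext i
        simp
      · convert W.add_mem (W.smul_mem a.re hx.2) (W.smul_mem a.im hx.1) using 1
        ext i
        simp
  · rintro ⟨hre, him⟩
    have h1 : (fun i => ((x i).re : ℂ)) ∈ complexify W := Submodule.subset_span ⟨_, hre, rfl⟩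
    have h2 : (fun i => ((x i).im : ℂ)) ∈ complexify W := Submodule.subset_span ⟨_, him, rfl⟩
    convert (complexify W).add_mem h1 ((complexify W).smul_mem Complex.I h2) using 1
    ext i
    simp [mul_comm Complex.I, Complex.re_add_im]

theorem ofReal_mem_complexify {n : ℕ} {W : Submodule ℝ (EuclideanSpace ℝ (Fin n))}
    {w : EuclideanSpace ℝ (Fin n)} (hw : w ∈ W) : (fun i => (w i : ℂ)) ∈ complexify W :=
  Submodule.subset_span ⟨w, hw, rfl⟩

theorem conj_mem_complexify {n : ℕ} {W : Submodule ℝ (EuclideanSpace ℝ (Fin n))} {x : Fin n → ℂ}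
    (hx : x ∈ complexify W) : (fun i => starRingEnd ℂ (x i)) ∈ complexify W := by
  rw [mem_complexify] at hx ⊢
  refine ⟨by simpa using hx.1, ?_⟩
  convert W.neg_mem hx.2 using 1
  ext i
  simp

/-! ### Zariski closed subsets of projective space -/

theorem eval_smul_of_isHomogeneous {n k : ℕ} {f : MvPolynomial (Fin n) ℂ} (hf : f.IsHomogeneous k)
    (c : ℂ) (v : Fin n → ℂ) :
    MvPolynomial.eval (c • v) f = c ^ k * MvPolynomial.eval v f := by
  rw [MvPolynomial.eval_eq, MvPolynomial.eval_eq, Finset.mul_sum]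
  refine Finset.sum_congr rfl fun m hm => ?_
  have : m.degree = k := by
    have := hf (MvPolynomial.mem_support_iff.1 hm)
    rwa [Finsupp.degree_eq_weight_one]
  simp only [Pi.smul_apply, smul_eq_mul, mul_pow, Finset.prod_mul_distrib,
    Finset.prod_pow_eq_pow_sum]
  rw [← Finsupp.degree_apply, this]
  ring

theorem eval_rep_eq_zero_iff {n k : ℕ} {f : MvPolynomial (Fin n) ℂ} (hf : f.IsHomogeneous k)
    {v : Fin n → ℂ} (hv : v ≠ 0) :
    MvPolynomial.eval (Projectivization.mk ℂ v hv).rep f = 0 ↔ MvPolynomial.eval v f = 0 := by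
  obtain ⟨a, ha⟩ := Projectivization.exists_smul_eq_mk_rep ℂ v hv
  rw [← ha, Units.smul_def, eval_smul_of_isHomogeneous hf]
  simp

theorem subset_zariskiClosure {n : ℕ} (S : Set (ℙ ℂ (Fin n → ℂ))) : S ⊆ zariskiClosure S :=
  fun p hp _ _ _ h => h p hp

theorem zariskiClosure_zariskiClosure {n : ℕ} (S : Set (ℙ ℂ (Fin n → ℂ))) :
    zariskiClosure (zariskiClosure S) = zariskiClosure S :=
  Set.Subset.antisymm (fun _ hp k f hf h => hp k f hf fun _ hq => hq k f hf h)
    (subset_zariskiClosure _)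

theorem zariskiClosure_empty (n : ℕ) : zariskiClosure (∅ : Set (ℙ ℂ (Fin n → ℂ))) = ∅ := by
  ext p
  simp only [Set.mem_empty_iff_false, iff_false]
  intro hp
  simpa using hp 0 1 (MvPolynomial.isHomogeneous_one _ _) (by simp)

theorem isQuasiProjective_zariskiClosure {n : ℕ} (S : Set (ℙ ℂ (Fin n → ℂ))) :
    IsQuasiProjective (zariskiClosure S) :=
  ⟨zariskiClosure S, ∅, zariskiClosure_zariskiClosure S, zariskiClosure_empty n, by simp⟩

/-! ### Points of a reciprocal linear space -/

/-- A homogeneous polynomial vanishes on `L⁻¹` as soon as it vanishes at the coordinatewise inverses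
of the vectors of `L_ℂ` in the torus. -/
theorem eval_eq_zero_of_mk_mem_reciprocal {n k : ℕ}
    {L : Submodule ℝ (EuclideanSpace ℝ (Fin n))}
    {v : Fin n → ℂ} {hv : v ≠ 0} (h : Projectivization.mk ℂ v hv ∈ reciprocal L)
    {f : MvPolynomial (Fin n) ℂ} (hf : f.IsHomogeneous k)
    (hz : ∀ x ∈ complexify L, (∀ i, x i ≠ 0) → MvPolynomial.eval (fun i => (x i)⁻¹) f = 0) :
    MvPolynomial.eval v f = 0 := by
  rw [← eval_rep_eq_zero_iff hf hv]
  refine h k f hf ?_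
  rintro _ ⟨x, hx, hx0, h0, rfl⟩
  rw [eval_rep_eq_zero_iff hf]
  exact hz x hx hx0

/-- For every `p ∈ L⁻¹` some `x ∈ L_ℂ` satisfies `x_i p_i = 1` on the support of `p`. -/
theorem exists_inv_mem_complexify {n : ℕ} {L : Submodule ℝ (EuclideanSpace ℝ (Fin n))}
    {p : Fin n → ℂ} {hp : p ≠ 0} (h : Projectivization.mk ℂ p hp ∈ reciprocal L) :
    ∃ x ∈ complexify L, ∀ i, p i ≠ 0 → x i = (p i)⁻¹ := by
  classical
  let Z : Submodule ℂ (Fin n → ℂ) :=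
    { carrier := {z | ∀ i, p i ≠ 0 → z i = 0}
      add_mem' := fun ha hb i hi => by simp [ha i hi, hb i hi]
      zero_mem' := fun i _ => rfl
      smul_mem' := fun c a ha i hi => by simp [ha i hi] }
  suffices hq : (fun i => (p i)⁻¹) ∈ complexify L ⊔ Z by
    obtain ⟨x, hx, z, hz, hxz⟩ := Submodule.mem_sup.1 hq
    refine ⟨x, hx, fun i hi => ?_⟩
    rw [← congrFun hxz i, Pi.add_apply, hz i hi, add_zero]
  by_contra hq
  -- A functional vanishing on `L_ℂ ⊔ Z` is a linear relation on `L` supported on the support of `p`.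
  obtain ⟨φ, hφq, hφ⟩ := Submodule.exists_le_ker_of_notMem hq
  set a : Fin n → ℂ := fun i => φ (Pi.single i 1) with ha
  have hφa : ∀ z, φ z = ∑ i, a i * z i := fun z => by
    rw [LinearMap.pi_apply_eq_sum_univ φ z]
    refine Finset.sum_congr rfl fun i _ => ?_
    rw [smul_eq_mul, mul_comm, ha]
    congr 2
    ext j
    simp [Pi.single_apply, eq_comm]
  set S : Finset (Fin n) := Finset.univ.filter fun i => p i ≠ 0 with hS
  have haS : ∀ i ∉ S, a i = 0 := fun i hi => by
    have hpi : p i = 0 := by simpa [hS] using hi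
    refine hφ (Submodule.mem_sup_right fun j hj => ?_)
    exact Pi.single_eq_of_ne (fun hji => hj (by rw [hji]; exact hpi)) _
  have hsum : ∀ z, φ z = ∑ i ∈ S, a i * z i := fun z => by
    rw [hφa]
    refine (Finset.sum_subset (Finset.subset_univ S) fun i _ hi => ?_).symm
    rw [haS i hi, zero_mul]
  -- The circuit polynomial of this relation.
  let f : MvPolynomial (Fin n) ℂ :=
    ∑ i ∈ S, MvPolynomial.C (a i) * ∏ j ∈ S.erase i, MvPolynomial.X j
  have hf : f.IsHomogeneous (S.card - 1) := by
    refine MvPolynomial.IsHomogeneous.sum _ _ _ fun i hi => ?_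
    have h1 := MvPolynomial.IsHomogeneous.prod (S.erase i)
      (fun j => (MvPolynomial.X j : MvPolynomial (Fin n) ℂ)) (fun _ => 1)
      fun j _ => MvPolynomial.isHomogeneous_X ℂ j
    have h2 := (MvPolynomial.isHomogeneous_C (Fin n) (a i)).mul h1
    simpa [Finset.card_erase_of_mem hi] using h2
  have heval : ∀ y : Fin n → ℂ, (∀ i ∈ S, y i ≠ 0) →
      MvPolynomial.eval y f = (∏ j ∈ S, y j) * φ (fun i => (y i)⁻¹) := fun y hy => by
    rw [hsum, Finset.mul_sum]
    simp only [f, map_sum, map_mul, map_prod, MvPolynomial.eval_C, MvPolynomial.eval_X]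
    refine Finset.sum_congr rfl fun i hi => ?_
    rw [← Finset.mul_prod_erase S y hi]
    field_simp [hy i hi]
  have hfp : MvPolynomial.eval p f = 0 := by
    refine eval_eq_zero_of_mk_mem_reciprocal h hf fun x hx hx0 => ?_
    rw [heval _ fun i _ => inv_ne_zero (hx0 i)]
    simp only [inv_inv]
    rw [show φ (fun i => x i) = 0 from hφ (Submodule.mem_sup_left hx), mul_zero]
  rw [heval p fun i hi => by simpa [hS] using hi, mul_eq_zero] at hfp
  rcases hfp with h0 | h0
  · rw [Finset.prod_eq_zero_iff] at h0
    obtain ⟨i, hi, h0⟩ := h0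
    exact (by simpa [hS] using hi : p i ≠ 0) h0
  · exact hφq h0

theorem inv_mem_affineCone_reciprocal {n : ℕ} {L : Submodule ℝ (EuclideanSpace ℝ (Fin n))}
    {x : Fin n → ℂ} (hx : x ∈ complexify L) (hx0 : ∀ i, x i ≠ 0) :
    (fun i => (x i)⁻¹) ∈ affineCone (reciprocal L) :=
  fun h => subset_zariskiClosure _ ⟨x, hx, hx0, h, rfl⟩

theorem conj_mem_affineCone_reciprocal {n : ℕ} {L : Submodule ℝ (EuclideanSpace ℝ (Fin n))}
    {v : Fin n → ℂ} (hv : v ∈ affineCone (reciprocal L)) :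
    (fun i => starRingEnd ℂ (v i)) ∈ affineCone (reciprocal L) := by
  intro hcv
  have hv0 : v ≠ 0 := fun h => hcv (by ext i; simp [h])
  have heval : ∀ (f : MvPolynomial (Fin n) ℂ) (y : Fin n → ℂ),
      MvPolynomial.eval (fun i => starRingEnd ℂ (y i)) f =
        starRingEnd ℂ (MvPolynomial.eval y (MvPolynomial.map (starRingEnd ℂ) f)) := fun f y => by
    rw [MvPolynomial.eval_map, MvPolynomial.hom_eval₂, MvPolynomial.eval, MvPolynomial.eval₂Hom]
    rw [show (starRingEnd ℂ).comp (starRingEnd ℂ) = RingHom.id ℂ from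
      RingHom.ext fun z => Complex.conj_conj z]
    rfl
  intro k f hf hz
  rw [eval_rep_eq_zero_iff hf, heval, map_eq_zero]
  refine eval_eq_zero_of_mk_mem_reciprocal (hv hv0) (hf.map _) fun x hx hx0 => ?_
  rw [← map_eq_zero (starRingEnd ℂ), ← heval]
  simp only [map_inv₀]
  rcases eq_or_ne (fun i => (starRingEnd ℂ (x i))⁻¹) 0 with h0 | h0
  · exact absurd (funext fun i => by
      have := congrFun h0 i
      simp_all) hv0
  · rw [← eval_rep_eq_zero_iff hf h0]
    exact hz _ ⟨_, conj_mem_complexify hx, by simpa using hx0, h0, rfl⟩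

/-! ### Krull dimension and transcendence degree -/

/-- Incomparability gives `≤`, lying over and going up give `≥`. -/
theorem ringKrullDim_eq_of_isIntegral (R S : Type*) [CommRing R] [CommRing S] [Algebra R S]
    [Algebra.IsIntegral R S] [FaithfulSMul R S] : ringKrullDim S = ringKrullDim R := by
  refine le_antisymm ?_ ?_
  · exact Order.krullDim_le_of_strictMono (PrimeSpectrum.comap (algebraMap R S))
      fun I J hIJ => Ideal.IsIntegral.comap_lt_comap (I := I.asIdeal) (J := J.asIdeal) hIJ
  · refine iSup_le fun l => ?_
    obtain ⟨P, -, hP, hl⟩ := Ideal.exists_ideal_over_prime_of_isIntegral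
      l.head.asIdeal (⊥ : Ideal S) (by
        rw [← RingHom.ker_eq_comap_bot, (RingHom.injective_iff_ker_eq_bot _).1 (FaithfulSMul.algebraMap_injective R S)]
        exact bot_le)
    have : P.LiesOver (RelSeries.head l).asIdeal := ⟨hl.symm⟩
    obtain ⟨l', hlen, -⟩ := Ideal.exists_ltSeries_of_hasGoingUp l P
    rw [← hlen]
    exact Order.LTSeries.length_le_krullDim l'

theorem ringKrullDim_eq_of_trdeg_eq {k A : Type} [Field k] [CommRing A] [IsDomain A] [Algebra k A]
    [Algebra.FiniteType k A] {d : ℕ} (h : Algebra.trdeg k A = d) : ringKrullDim A = d := by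
  obtain ⟨s, g, hinj, hint⟩ := exists_integral_inj_algHom_of_fg k A
  algebraize [g.toRingHom]
  have : IsScalarTower k (MvPolynomial (Fin s) k) A :=
    IsScalarTower.of_algebraMap_eq fun r => (g.commutes r).symm
  have : FaithfulSMul (MvPolynomial (Fin s) k) A :=
    (faithfulSMul_iff_algebraMap_injective _ _).2 hinj
  have : Algebra.IsIntegral (MvPolynomial (Fin s) k) A := ⟨hint⟩
  have hadd := trdeg_add_eq k (MvPolynomial (Fin s) k) (A := A)
  rw [trdeg_eq_zero (R := MvPolynomial (Fin s) k), add_zero, h, MvPolynomial.trdeg_of_isDomain] at hadd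
  have hs : s = d := by simpa using hadd
  rw [ringKrullDim_eq_of_isIntegral (MvPolynomial (Fin s) k) A,
    MvPolynomial.ringKrullDim_of_isNoetherianRing, hs]
  simp

/-- If the span of the `ℓ_i` contains the variables `t_1, …, t_d`, then the field `k(t_1, …, t_d)` is
algebraic over the subalgebra generated by the `ℓ_i⁻¹`, which thus has transcendence degree `d`. -/
theorem trdeg_range_aeval_inv {k : Type} [Field k] {n d : ℕ}
    (ℓ : Fin n → MvPolynomial (Fin d) k)
    (hspan : ∀ j, MvPolynomial.X j ∈ Submodule.span k (Set.range ℓ)) :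
    Algebra.trdeg k (MvPolynomial.aeval (R := k) fun i =>
      (algebraMap _ (FractionRing (MvPolynomial (Fin d) k)) (ℓ i))⁻¹).range = d := by
  set K := FractionRing (MvPolynomial (Fin d) k)
  set φ : MvPolynomial (Fin n) k →ₐ[k] K :=
    MvPolynomial.aeval (R := k) fun i => (algebraMap _ K (ℓ i))⁻¹ with hφ
  have hK : Algebra.trdeg k K = d := by
    have : Algebra.IsAlgebraic (MvPolynomial (Fin d) k) K :=
      IsLocalization.isAlgebraic _ (nonZeroDivisors (MvPolynomial (Fin d) k))
    have hadd := trdeg_add_eq k (MvPolynomial (Fin d) k) (A := K)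
    rw [trdeg_eq_zero (R := MvPolynomial (Fin d) k), add_zero, MvPolynomial.trdeg_of_isDomain] at hadd
    simpa using hadd.symm
  have hX : ∀ f : MvPolynomial (Fin d) k, IsAlgebraic φ.range (algebraMap _ K f) := fun f => by
    let T : Subalgebra k K := (Subalgebra.algebraicClosure φ.range K).restrictScalars k
    have hT : ∀ x, x ∈ T ↔ IsAlgebraic φ.range x := fun x => Iff.rfl
    have hℓ : ∀ i, algebraMap _ K (ℓ i) ∈ T := fun i => by
      rw [hT, ← inv_inv (algebraMap _ K (ℓ i))]
      refine IsAlgebraic.inv ?_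
      have : (algebraMap _ K (ℓ i))⁻¹ ∈ φ.range := ⟨MvPolynomial.X i, by simp [hφ]⟩
      exact isAlgebraic_algebraMap (⟨_, this⟩ : φ.range)
    have hXj : ∀ j, algebraMap _ K (MvPolynomial.X j : MvPolynomial (Fin d) k) ∈ T := fun j => by
      have hle : Submodule.span k (Set.range ℓ) ≤ (Subalgebra.toSubmodule T).comap
          (IsScalarTower.toAlgHom k (MvPolynomial (Fin d) k) K).toLinearMap :=
        Submodule.span_le.2 (by rintro _ ⟨i, rfl⟩; exact hℓ i)
      exact hle (hspan j)
    rw [← hT]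
    induction f using MvPolynomial.induction_on with
    | C a =>
      exact T.algebraMap_mem a
    | add p q hp hq => rw [map_add]; exact T.add_mem hp hq
    | mul_X p j hp => rw [map_mul]; exact T.mul_mem hp (hXj j)
  have : Algebra.IsAlgebraic φ.range K := ⟨fun z => by
    obtain ⟨f, g, -, rfl⟩ := IsFractionRing.div_surjective (A := MvPolynomial (Fin d) k) z
    rw [div_eq_mul_inv]
    exact (hX f).mul (hX g).inv⟩
  have hadd := trdeg_add_eq k φ.range (A := K)
  rw [trdeg_eq_zero (R := φ.range), add_zero, hK] at hadd
  exact hadd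

/-! ### The codimension of a reciprocal linear space -/

theorem exists_mem_forall_ne_zero {n : ℕ} {L : Submodule ℝ (EuclideanSpace ℝ (Fin n))}
    (hL : ∀ i : Fin n, ∃ x ∈ L, x i ≠ 0) : ∃ x ∈ L, ∀ i, x i ≠ 0 := by
  obtain ⟨x, hx⟩ := Module.Dual.exists_forall_ne_zero_of_forall_exists
    (fun i => ((EuclideanSpace.proj i : EuclideanSpace ℝ (Fin n) →L[ℝ] ℝ).toLinearMap ∘ₗ
      L.subtype : L →ₗ[ℝ] ℝ)) fun i => by
        obtain ⟨x, hx, h⟩ := hL i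
        exact ⟨⟨x, hx⟩, h⟩
  exact ⟨x, x.2, hx⟩

/-- The homogeneous ideal of `L⁻¹` is the full ideal of the coordinatewise inverses of the vectors
of `L_ℂ` in the torus. -/
theorem mem_vanishingIdeal_affineCone_reciprocal {n : ℕ}
    {L : Submodule ℝ (EuclideanSpace ℝ (Fin n))} (hL : ∀ i : Fin n, ∃ x ∈ L, x i ≠ 0)
    {f : MvPolynomial (Fin n) ℂ} :
    f ∈ MvPolynomial.vanishingIdeal ℂ (affineCone (reciprocal L)) ↔
      ∀ x ∈ complexify L, (∀ i, x i ≠ 0) → MvPolynomial.eval (fun i => (x i)⁻¹) f = 0 := by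
  rw [MvPolynomial.mem_vanishingIdeal_iff]
  refine ⟨fun h x hx hx0 => by
    simpa [MvPolynomial.aeval_eq_eval] using h _ (inv_mem_affineCone_reciprocal hx hx0),
    fun h v hv => ?_⟩
  -- The set of inverses is stable under scaling, so each homogeneous component vanishes on it.
  have hcomp : ∀ k, ∀ x ∈ complexify L, (∀ i, x i ≠ 0) →
      MvPolynomial.eval (fun i => (x i)⁻¹) (MvPolynomial.homogeneousComponent k f) = 0 := by
    intro k x hx hx0
    let P : Polynomial ℂ := ∑ j ∈ Finset.range (f.totalDegree + 1), Polynomial.monomial j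
      (MvPolynomial.eval (fun i => (x i)⁻¹) (MvPolynomial.homogeneousComponent j f))
    have hP : ∀ c : ℂ, P.eval c = MvPolynomial.eval (c • fun i => (x i)⁻¹) f := fun c => by
      conv_rhs => rw [← MvPolynomial.sum_homogeneousComponent f, map_sum]
      simp only [P, Polynomial.eval_finsetSum, Polynomial.eval_monomial]
      refine Finset.sum_congr rfl fun j _ => ?_
      rw [eval_smul_of_isHomogeneous (MvPolynomial.homogeneousComponent_isHomogeneous j f),
        mul_comm]
    have hP0 : P = 0 := by
      refine Polynomial.eq_zero_of_infinite_isRoot P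
        (Set.Infinite.mono (s := {0}ᶜ) (fun c hc => ?_) (Set.finite_singleton 0).infinite_compl)
      change P.eval c = 0
      rw [hP]
      have hc' : c ≠ 0 := hc
      have := h (c⁻¹ • x) ((complexify L).smul_mem _ hx) fun i => by simp [hc', hx0 i]
      rwa [show (fun i => ((c⁻¹ • x) i)⁻¹) = c • fun i => (x i)⁻¹ from
        funext fun i => by simp [mul_comm]] at this
    by_cases hk : k ∈ Finset.range (f.totalDegree + 1)
    · have := congrArg (fun Q => Polynomial.coeff Q k) hP0
      simpa [P, Polynomial.finsetSum_coeff, Polynomial.coeff_monomial,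
        Finset.sum_ite_eq', Finset.mem_range.1 hk] using this
    · rw [MvPolynomial.homogeneousComponent_eq_zero _ _ (by simpa using hk), map_zero]
  rw [MvPolynomial.aeval_eq_eval, ← MvPolynomial.sum_homogeneousComponent f,
    map_sum]
  refine Finset.sum_eq_zero fun k _ => ?_
  have hhom := MvPolynomial.homogeneousComponent_isHomogeneous k f
  rcases eq_or_ne v 0 with rfl | hv0
  · -- At the origin only the constant component is nonzero, and it vanishes on a nonempty set.
    obtain ⟨w, hw, hw0⟩ := exists_mem_forall_ne_zero hL
    have h1 := hcomp k _ (ofReal_mem_complexify hw) (by simpa using hw0)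
    have h2 := eval_smul_of_isHomogeneous hhom 0 fun i => ((w i : ℂ))⁻¹
    rw [h1, zero_smul, mul_zero] at h2
    exact h2
  · exact eval_eq_zero_of_mk_mem_reciprocal (hv hv0) hhom (hcomp k)

/-- Clearing denominators in a polynomial in the inverses of the `ℓ_i`, simultaneously in the field
of fractions and at points. -/
theorem exists_clear_denominators {k : Type*} [Field k] {n d : ℕ}
    (ℓ : Fin n → MvPolynomial (Fin d) k) (hℓ : ∀ i, ℓ i ≠ 0) (f : MvPolynomial (Fin n) k) :
    ∃ (N : ℕ) (g : MvPolynomial (Fin d) k),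
      algebraMap _ (FractionRing (MvPolynomial (Fin d) k)) g =
        algebraMap _ (FractionRing (MvPolynomial (Fin d) k)) (∏ i, ℓ i) ^ N *
        MvPolynomial.aeval (R := k) (fun i =>
          (algebraMap _ (FractionRing (MvPolynomial (Fin d) k)) (ℓ i))⁻¹) f ∧
      ∀ t, (∀ i, MvPolynomial.eval t (ℓ i) ≠ 0) → MvPolynomial.eval t g =
        MvPolynomial.eval t (∏ i, ℓ i) ^ N *
          MvPolynomial.eval (fun i => (MvPolynomial.eval t (ℓ i))⁻¹) f := by
  classical
  induction f using MvPolynomial.induction_on with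
  | C a => exact ⟨0, MvPolynomial.C a, by simp [IsScalarTower.algebraMap_apply k
      (MvPolynomial (Fin d) k) (FractionRing (MvPolynomial (Fin d) k))], by simp⟩
  | add p q hp hq =>
    obtain ⟨N, g, h1, h2⟩ := hp
    obtain ⟨M, h, h3, h4⟩ := hq
    refine ⟨N + M, g * (∏ i, ℓ i) ^ M + h * (∏ i, ℓ i) ^ N, ?_, fun t ht => ?_⟩
    · rw [map_add, map_mul, map_mul, h1, h3, map_add, map_pow, map_pow]
      ring
    · rw [map_add, map_mul, map_mul, h2 t ht, h4 t ht, map_add, map_pow, map_pow]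
      ring
  | mul_X p j hp =>
    obtain ⟨N, g, h1, h2⟩ := hp
    refine ⟨N + 1, g * ∏ i ∈ Finset.univ.erase j, ℓ i, ?_, fun t ht => ?_⟩
    · have hj : algebraMap _ (FractionRing (MvPolynomial (Fin d) k)) (ℓ j) ≠ 0 := by
        simpa using hℓ j
      rw [map_mul, h1, map_mul, MvPolynomial.aeval_X, pow_succ,
        ← Finset.mul_prod_erase Finset.univ ℓ (Finset.mem_univ j), map_mul]
      field_simp
    · have hj := ht j
      rw [map_mul, h2 t ht, map_mul, MvPolynomial.eval_X, pow_succ,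
        ← Finset.mul_prod_erase Finset.univ ℓ (Finset.mem_univ j), map_mul]
      field_simp

/-- A polynomial in the inverses of nonzero polynomials `ℓ_i` is zero if and only if it vanishes at
every point where none of the `ℓ_i` does. -/
theorem aeval_inv_eq_zero_iff {k : Type*} [Field k] [Infinite k] {n d : ℕ}
    (ℓ : Fin n → MvPolynomial (Fin d) k) (hℓ : ∀ i, ℓ i ≠ 0) (f : MvPolynomial (Fin n) k) :
    MvPolynomial.aeval (R := k) (fun i =>
        (algebraMap _ (FractionRing (MvPolynomial (Fin d) k)) (ℓ i))⁻¹) f = 0 ↔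
      ∀ t, (∀ i, MvPolynomial.eval t (ℓ i) ≠ 0) →
        MvPolynomial.eval (fun i => (MvPolynomial.eval t (ℓ i))⁻¹) f = 0 := by
  obtain ⟨N, g, h1, h2⟩ := exists_clear_denominators ℓ hℓ f
  have hprod : (∏ i, ℓ i) ≠ 0 := Finset.prod_ne_zero_iff.2 fun i _ => hℓ i
  constructor
  · intro h t ht
    rw [h, mul_zero] at h1
    have hg : g = 0 := by simpa using h1
    have := h2 t ht
    rw [hg, map_zero] at this
    have hne : MvPolynomial.eval t (∏ i, ℓ i) ≠ 0 := by
      rw [map_prod]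
      exact Finset.prod_ne_zero_iff.2 fun i _ => ht i
    exact (mul_eq_zero.1 this.symm).resolve_left (pow_ne_zero _ hne)
  · intro h
    have hg : g * ∏ i, ℓ i = 0 := by
      refine MvPolynomial.funext fun t => ?_
      rw [map_mul, map_zero, map_prod]
      by_cases ht : ∀ i, MvPolynomial.eval t (ℓ i) ≠ 0
      · rw [h2 t ht, h t ht, mul_zero, zero_mul]
      · push Not at ht
        obtain ⟨i, hi⟩ := ht
        rw [Finset.prod_eq_zero (Finset.mem_univ i) hi, mul_zero]
    rw [(mul_eq_zero.1 hg).resolve_right hprod, map_zero] at h1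
    have hne : algebraMap _ (FractionRing (MvPolynomial (Fin d) k)) (∏ i, ℓ i) ≠ 0 :=
      (map_ne_zero_iff _ (IsFractionRing.injective _ _)).2 hprod
    exact (mul_eq_zero.1 h1.symm).resolve_left (pow_ne_zero _ hne)

theorem ringKrullDim_coordinateRing_reciprocal {n d : ℕ}
    {L : Submodule ℝ (EuclideanSpace ℝ (Fin n))} (hd : Module.finrank ℝ L = d)
    (hL : ∀ i : Fin n, ∃ x ∈ L, x i ≠ 0) :
    ringKrullDim (CoordinateRing (reciprocal L)) = d := by
  let b : Module.Basis (Fin d) ℝ L := Module.finBasisOfFinrankEq ℝ L hd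
  let ℓ : Fin n → MvPolynomial (Fin d) ℂ := fun i =>
    ∑ j, MvPolynomial.C ((b j : EuclideanSpace ℝ (Fin n)) i : ℂ) * MvPolynomial.X j
  have heval : ∀ t i, MvPolynomial.eval t (ℓ i) =
      ∑ j, ((b j : EuclideanSpace ℝ (Fin n)) i : ℂ) * t j := fun t i => by
    simp [ℓ]
  have hmem : ∀ t, (fun i => MvPolynomial.eval t (ℓ i)) ∈ complexify L := fun t => by
    have : (fun i => MvPolynomial.eval t (ℓ i)) =
        ∑ j, t j • fun i => ((b j : EuclideanSpace ℝ (Fin n)) i : ℂ) := by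
      ext i
      simp [heval, mul_comm]
    rw [this]
    exact Submodule.sum_mem _ fun j _ =>
      Submodule.smul_mem _ _ (ofReal_mem_complexify (b j).2)
  have hreal : ∀ x ∈ L, ∃ t : Fin d → ℝ, ∀ i, x i = ∑ j, (b j : EuclideanSpace ℝ (Fin n)) i * t j :=
    fun x hx => ⟨fun j => b.repr ⟨x, hx⟩ j, fun i => by
      have := congrArg (fun y : L => (y : EuclideanSpace ℝ (Fin n)) i) (b.sum_repr ⟨x, hx⟩)
      simpa [mul_comm, -Module.Basis.sum_repr] using this.symm⟩
  have hsurj : ∀ x ∈ complexify L, ∃ t, x = fun i => MvPolynomial.eval t (ℓ i) := fun x hx => by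
    rw [mem_complexify] at hx
    obtain ⟨t, ht⟩ := hreal _ hx.1
    obtain ⟨u, hu⟩ := hreal _ hx.2
    refine ⟨fun j => t j + u j * Complex.I, ?_⟩
    ext i
    have h1 : (x i).re = _ := ht i
    have h2 : (x i).im = _ := hu i
    rw [← Complex.re_add_im (x i), h1, h2, heval]
    push_cast
    rw [Finset.sum_mul, ← Finset.sum_add_distrib]
    exact Finset.sum_congr rfl fun j _ => by ring
  have hℓ : ∀ i, ℓ i ≠ 0 := fun i h0 => by
    obtain ⟨x, hx, hxi⟩ := hL i
    obtain ⟨t, ht⟩ := hsurj _ (ofReal_mem_complexify hx)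
    have := congrFun ht i
    rw [h0, map_zero] at this
    exact hxi (by simpa using this)
  -- Each coordinate functional of the basis `b` of `L` extends to a linear functional on `ℝⁿ`.
  have hspan : ∀ j, MvPolynomial.X j ∈ Submodule.span ℂ (Set.range ℓ) := fun j => by
    obtain ⟨ψ, hψ⟩ := (b.coord j).exists_extend
    rw [Submodule.mem_span_range_iff_exists_fun]
    refine ⟨fun i => (ψ (EuclideanSpace.single i 1) : ℂ), ?_⟩
    have key : ∀ m, ∑ i, (ψ (EuclideanSpace.single i 1)) * (b m : EuclideanSpace ℝ (Fin n)) i =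
        if m = j then 1 else 0 := fun m => by
      have h1 : ψ (b m) = b.coord j (b m) := by rw [← hψ]; rfl
      rw [Module.Basis.coord_apply, b.repr_self, Finsupp.single_apply] at h1
      rw [← h1]
      conv_rhs => rw [← (EuclideanSpace.basisFun (Fin n) ℝ).sum_repr (b m : EuclideanSpace ℝ (Fin n))]
      simp [map_sum, mul_comm]
    simp only [ℓ, Finset.smul_sum, MvPolynomial.smul_eq_C_mul]
    rw [Finset.sum_comm]
    have : ∀ m, ∑ i, MvPolynomial.C (ψ (EuclideanSpace.single i 1) : ℂ) *
        (MvPolynomial.C ((b m : EuclideanSpace ℝ (Fin n)) i : ℂ) * MvPolynomial.X m) =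
        (if m = j then MvPolynomial.X m else 0 : MvPolynomial (Fin d) ℂ) := fun m => by
      simp_rw [← mul_assoc, ← map_mul, ← Finset.sum_mul, ← map_sum]
      have := congrArg (Complex.ofReal) (key m)
      push_cast at this
      rw [this]
      split_ifs <;> simp
    simp_rw [this]
    simp
  set φ := MvPolynomial.aeval (R := ℂ) (fun i =>
        (algebraMap _ (FractionRing (MvPolynomial (Fin d) ℂ)) (ℓ i))⁻¹) with hφ
  have hker : MvPolynomial.vanishingIdeal ℂ (affineCone (reciprocal L)) = RingHom.ker φ := by
    ext f
    rw [mem_vanishingIdeal_affineCone_reciprocal hL, RingHom.mem_ker, hφ,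
      aeval_inv_eq_zero_iff ℓ hℓ]
    refine ⟨fun h t ht => h _ (hmem t) ht, fun h x hx hx0 => ?_⟩
    obtain ⟨t, rfl⟩ := hsurj x hx
    exact h t hx0
  have hfin : Algebra.FiniteType ℂ φ.range :=
    Algebra.FiniteType.of_surjective φ.rangeRestrict φ.rangeRestrict_surjective
  rw [← ringKrullDim_eq_of_trdeg_eq (trdeg_range_aeval_inv ℓ hspan)]
  exact ringKrullDim_eq_of_ringEquiv ((Ideal.quotEquivOfEq hker).trans
    (Ideal.quotientKerEquivRange φ).toRingEquiv)

theorem isRealVariety_reciprocal {n c : ℕ} {L : Submodule ℝ (EuclideanSpace ℝ (Fin n))}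
    (hc : Module.finrank ℝ L + c = n) (hL : ∀ i : Fin n, ∃ x ∈ L, x i ≠ 0) :
    IsRealVariety (reciprocal L) c where
  quasiProjective := isQuasiProjective_zariskiClosure _
  conj_mem _ := conj_mem_affineCone_reciprocal
  codim := by
    rw [HasCodim, ringKrullDim_coordinateRing_reciprocal rfl hL]
    exact_mod_cast hc

/-! ### Hyperbolicity from a sign condition -/

/-- `M` and `L` are sign-transversal if no nonzero `p ∈ M` agrees in sign, on the support of `p`,
with some `x ∈ L`. -/
def SignTransversal {n : ℕ} (M L : Submodule ℝ (EuclideanSpace ℝ (Fin n))) : Prop :=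
  ∀ p ∈ M, ∀ x ∈ L, (∀ i, p i ≠ 0 → 0 < x i * p i) → p = 0

theorem signTransversal_orthogonal {n : ℕ} (L : Submodule ℝ (EuclideanSpace ℝ (Fin n))) :
    SignTransversal Lᗮ L := by
  intro p hp x hx h
  have h0 : ∑ i, x i * p i = 0 := by
    have := (Submodule.mem_orthogonal L p).1 hp x hx
    simpa [PiLp.inner_apply, mul_comm] using this
  have hnn : ∀ i ∈ Finset.univ, 0 ≤ x i * p i := fun i _ => by
    rcases eq_or_ne (p i) 0 with hi | hi
    · simp [hi]
    · exact (h i hi).le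
  ext i
  by_contra hi
  exact (h i hi).ne' ((Finset.sum_eq_zero_iff_of_nonneg hnn).1 h0 i (Finset.mem_univ i))

/-- If `x_i p_i = 1` on the support of `p`, then `p_i = |p_i|² x̄_i`: the real and the imaginary
part of `p` agree in sign with those of `x̄`. -/
theorem sign_compatible_of_inv {n : ℕ} {L : Submodule ℝ (EuclideanSpace ℝ (Fin n))} {p : Fin n → ℂ}
    {hp : p ≠ 0} (h : Projectivization.mk ℂ p hp ∈ reciprocal L) :
    (∃ y ∈ L, ∀ i, (p i).re ≠ 0 → 0 < y i * (p i).re) ∧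
      ∃ y ∈ L, ∀ i, (p i).im ≠ 0 → 0 < y i * (p i).im := by
  obtain ⟨x, hx, hxp⟩ := exists_inv_mem_complexify h
  have hx' := mem_complexify.1 (conj_mem_complexify hx)
  refine ⟨⟨_, hx'.1, fun i hi => ?_⟩, ⟨_, hx'.2, fun i hi => ?_⟩⟩
  · have hpi : p i ≠ 0 := fun h0 => hi (by simp [h0])
    have hpos := Complex.normSq_pos.2 hpi
    have : (starRingEnd ℂ (x i)).re * (p i).re = (p i).re ^ 2 / Complex.normSq (p i) := by
      rw [hxp i hpi, Complex.conj_re, Complex.inv_re]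
      ring
    change 0 < (starRingEnd ℂ (x i)).re * (p i).re
    rw [this]
    positivity
  · have hpi : p i ≠ 0 := fun h0 => hi (by simp [h0])
    have hpos := Complex.normSq_pos.2 hpi
    have : (starRingEnd ℂ (x i)).im * (p i).im = (p i).im ^ 2 / Complex.normSq (p i) := by
      rw [hxp i hpi, Complex.conj_im, Complex.inv_im]
      ring
    change 0 < (starRingEnd ℂ (x i)).im * (p i).im
    rw [this]
    positivity

theorem SignTransversal.notMem_complexify {n : ℕ} {M L : Submodule ℝ (EuclideanSpace ℝ (Fin n))}
    (hML : SignTransversal M L) {p : Fin n → ℂ} {hp : p ≠ 0}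
    (h : Projectivization.mk ℂ p hp ∈ reciprocal L) : p ∉ complexify M := by
  intro hpM
  obtain ⟨⟨y, hy, hyp⟩, z, hz, hzp⟩ := sign_compatible_of_inv h
  have hpM := mem_complexify.1 hpM
  have h1 := hML _ hpM.1 y hy hyp
  have h2 := hML _ hpM.2 z hz hzp
  refine hp (funext fun i => Complex.ext ?_ ?_)
  · exact congrArg (fun v : EuclideanSpace ℝ (Fin n) => v i) h1
  · exact congrArg (fun v : EuclideanSpace ℝ (Fin n) => v i) h2

theorem exists_eq_sup_span_singleton {V : Type*} [AddCommGroup V] [Module ℝ V]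
    [FiniteDimensional ℝ V] {M M' : Submodule ℝ V} (hle : M ≤ M')
    (hrank : Module.finrank ℝ M' = Module.finrank ℝ M + 1) :
    ∃ v, M' = M ⊔ Submodule.span ℝ {v} := by
  obtain ⟨v, hv, hvM⟩ : ∃ v ∈ M', v ∉ M := by
    by_contra! hcon
    have := le_antisymm hle hcon
    rw [← this] at hrank
    omega
  have hsup : M ⊔ Submodule.span ℝ {v} ≤ M' :=
    sup_le hle ((Submodule.span_singleton_le_iff_mem _ _).2 hv)
  refine ⟨v, (Submodule.eq_of_le_of_finrank_le hsup ?_).symm⟩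
  rw [hrank]
  refine Submodule.finrank_lt_finrank_of_lt (lt_of_le_of_ne le_sup_left fun h => hvM ?_)
  rw [h]
  exact Submodule.mem_sup_right (Submodule.mem_span_singleton_self v)

/-- Let `p = u + γ v` with `u ∈ M_ℂ`. Transversality gives `γ ≠ 0`, so `p` can be scaled to `γ = 1`;
then the imaginary part of `p` lies in `M` and vanishes, again by transversality. -/
theorem SignTransversal.isRealPoint {n : ℕ} {M M' L : Submodule ℝ (EuclideanSpace ℝ (Fin n))}
    (hML : SignTransversal M L) (hle : M ≤ M')
    (hrank : Module.finrank ℝ M' = Module.finrank ℝ M + 1) {p : ℙ ℂ (Fin n → ℂ)}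
    (hp : p ∈ reciprocal L) (hpM : p.rep ∈ complexify M') : IsRealPoint p := by
  obtain ⟨v, rfl⟩ := exists_eq_sup_span_singleton hle hrank
  have hpM2 := mem_complexify.1 hpM
  obtain ⟨a, ha, a', ha', hre⟩ := Submodule.mem_sup.1 hpM2.1
  obtain ⟨b, hb, b', hb', him⟩ := Submodule.mem_sup.1 hpM2.2
  obtain ⟨α, rfl⟩ := Submodule.mem_span_singleton.1 ha'
  obtain ⟨β, rfl⟩ := Submodule.mem_span_singleton.1 hb'
  have hre' : ∀ i, (p.rep i).re = a i + α * v i := fun i =>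
    (congrArg (fun w : EuclideanSpace ℝ (Fin n) => w i) hre).symm
  have him' : ∀ i, (p.rep i).im = b i + β * v i := fun i =>
    (congrArg (fun w : EuclideanSpace ℝ (Fin n) => w i) him).symm
  set γ : ℂ := ⟨α, β⟩ with hγ
  set u : Fin n → ℂ := fun i => ⟨a i, b i⟩ with hu
  have huM : u ∈ complexify M := mem_complexify.2 ⟨ha, hb⟩
  have hpu : ∀ i, p.rep i = u i + γ * v i := fun i => by
    apply Complex.ext <;> simp [hre', him', hu, hγ]
  have hmk : Projectivization.mk ℂ p.rep p.rep_nonzero ∈ reciprocal L := by rwa [p.mk_rep]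
  have hγ0 : γ ≠ 0 := fun h0 => by
    refine hML.notMem_complexify hmk ?_
    convert huM using 1
    ext i
    rw [hpu, h0, zero_mul, add_zero]
  have hq0 : γ⁻¹ • p.rep ≠ 0 := smul_ne_zero (inv_ne_zero hγ0) p.rep_nonzero
  have hq : p = Projectivization.mk ℂ (γ⁻¹ • p.rep) hq0 := by
    conv_lhs => rw [← p.mk_rep]
    rw [Projectivization.mk_eq_mk_iff']
    exact ⟨γ, by rw [smul_smul, mul_inv_cancel₀ hγ0, one_smul]⟩
  have hqM : WithLp.toLp 2 (fun i => ((γ⁻¹ • p.rep) i).im) ∈ M := by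
    convert (mem_complexify.1 ((complexify M).smul_mem γ⁻¹ huM)).2 using 2
    ext i
    rw [Pi.smul_apply, Pi.smul_apply, hpu, smul_add, Complex.add_im, smul_eq_mul, smul_eq_mul,
      inv_mul_cancel_left₀ hγ0, Complex.ofReal_im, add_zero]
  obtain ⟨-, y, hy, hyq⟩ := sign_compatible_of_inv (hq ▸ hp)
  have him0 := hML _ hqM y hy hyq
  have hreal : (fun i => (((γ⁻¹ • p.rep) i).re : ℂ)) = γ⁻¹ • p.rep := by
    ext i
    refine Complex.ext (by simp) ?_
    rw [Complex.ofReal_im]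
    exact (congrArg (fun w : EuclideanSpace ℝ (Fin n) => w i) him0).symm
  exact ⟨fun i => ((γ⁻¹ • p.rep) i).re, hreal ▸ hq0, by simp only [hreal]; exact hq⟩

theorem SignTransversal.isHyperbolic {n : ℕ} {M L : Submodule ℝ (EuclideanSpace ℝ (Fin n))}
    (hML : SignTransversal M L)
    (hvar : IsRealVariety (reciprocal L) (Module.finrank ℝ M)) :
    IsHyperbolic (reciprocal L) M where
  variety := hvar
  inter_eq_empty := by
    refine Set.eq_empty_of_forall_notMem fun p hp => ?_
    exact hML.notMem_complexify (hp := p.rep_nonzero) (by rw [p.mk_rep]; exact hp.1) hp.2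
  real_points _ hle hrank _ hp := hML.isRealPoint hle hrank hp.1 hp.2

/-! ### The Cauchy–Binet formula -/

/-- The Cauchy–Binet formula. -/
theorem det_mul_eq_sum_minors {R : Type*} [CommRing R] {c n : ℕ} (A : Matrix (Fin c) (Fin n) R)
    (B : Matrix (Fin n) (Fin c) R) :
    (A * B).det = ∑ I : Subsets c n, (A.submatrix id (I.1.orderEmbOfFin I.2)).det *
      (B.submatrix (I.1.orderEmbOfFin I.2) id).det := by
  classical
  have hl : (A * B).det = ∑ f : Fin c → Fin n, (∏ i, A i (f i)) * (B.submatrix f id).det := by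
    have hrow : (A * B : Matrix _ _ R) = fun i => ∑ k, A i k • B k := by
      ext i j
      simp [Matrix.mul_apply, Finset.sum_apply]
    have := (Matrix.detRowAlternating (n := Fin c) (R := R)).toMultilinearMap.map_sum
      (fun i k => A i k • B k)
    rw [hrow]
    refine this.trans (Finset.sum_congr rfl fun f _ => ?_)
    exact (Matrix.detRowAlternating (n := Fin c) (R := R)).toMultilinearMap.map_smul_univ
      (fun i => A i (f i)) (fun i => B (f i))
  have hr : ∀ I : Subsets c n, (A.submatrix id (I.1.orderEmbOfFin I.2)).det *
      (B.submatrix (I.1.orderEmbOfFin I.2) id).det =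
      ∑ τ : Equiv.Perm (Fin c), (∏ i, A i (I.1.orderEmbOfFin I.2 (τ i))) *
        (B.submatrix (fun i => I.1.orderEmbOfFin I.2 (τ i)) id).det := fun I => by
    rw [← Matrix.det_transpose (A.submatrix _ _), Matrix.det_apply', Finset.sum_mul]
    refine Finset.sum_congr rfl fun τ _ => ?_
    have := Matrix.det_permute τ (B.submatrix (I.1.orderEmbOfFin I.2) id)
    rw [Matrix.submatrix_submatrix] at this
    change _ = _ * (B.submatrix ((I.1.orderEmbOfFin I.2) ∘ τ) (id ∘ id)).det
    rw [this]
    simp only [Matrix.transpose_apply, Matrix.submatrix_apply, id]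
    ring
  simp_rw [hl, hr]
  rw [← Fintype.sum_prod_type' (f := fun (I : Subsets c n) (τ : Equiv.Perm (Fin c)) =>
    (∏ i, A i (I.1.orderEmbOfFin I.2 (τ i))) *
        (B.submatrix (fun i => I.1.orderEmbOfFin I.2 (τ i)) id).det)]
  symm
  have himg : ∀ (I : Subsets c n) (τ : Equiv.Perm (Fin c)),
      Finset.univ.image (fun i => I.1.orderEmbOfFin I.2 (τ i)) = I.1 := fun I τ => by
    ext k
    constructor
    · intro hk
      obtain ⟨i, -, rfl⟩ := Finset.mem_image.1 hk
      exact Finset.orderEmbOfFin_mem _ _ _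
    · intro hk
      have : k ∈ Set.range (I.1.orderEmbOfFin I.2) := by
        rw [Finset.range_orderEmbOfFin]; exact hk
      obtain ⟨j, rfl⟩ := this
      exact Finset.mem_image.2 ⟨τ.symm j, Finset.mem_univ _, by simp⟩
  refine Finset.sum_of_injOn (fun (x : Subsets c n × Equiv.Perm (Fin c)) (i : Fin c) =>
    x.1.1.orderEmbOfFin x.1.2 (x.2 i)) ?_ (fun _ _ => Finset.mem_univ _) ?_ fun _ _ => rfl
  · rintro ⟨I, τ⟩ - ⟨J, ρ⟩ - h
    have hIJ : I = J := by
      apply Subtype.ext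
      rw [← himg I τ, ← himg J ρ]
      exact congrArg (fun g => Finset.univ.image g) h
    subst hIJ
    refine Prod.ext rfl (Equiv.ext fun i => ?_)
    exact (I.1.orderEmbOfFin I.2).injective (congrFun h i)
  · intro f _ hf
    by_cases hinj : Function.Injective f
    · refine absurd ?_ hf
      let I : Subsets c n := ⟨Finset.univ.image f, by
        rw [Finset.card_image_of_injective _ hinj, Finset.card_univ, Fintype.card_fin]⟩
      let e := I.1.orderIsoOfFin I.2
      have hmem : ∀ i, f i ∈ I.1 := fun i => Finset.mem_image_of_mem f (Finset.mem_univ i)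
      have hτ : Function.Injective fun i => e.symm ⟨f i, hmem i⟩ := fun i j h =>
        hinj (by simpa using h)
      refine ⟨(I, Equiv.ofBijective _ (Finite.injective_iff_bijective.1 hτ)),
        by simp, funext fun i => ?_⟩
      change I.1.orderEmbOfFin I.2 (e.symm ⟨f i, hmem i⟩) = f i
      rw [← Finset.coe_orderIsoOfFin_apply]
      simp [e]
    · rw [Function.Injective] at hinj
      push Not at hinj
      obtain ⟨i, j, hij, hne⟩ := hinj
      rw [Matrix.det_zero_of_row_eq hne (by ext k; simp [hij]), mul_zero]

/-! ### Plücker coordinates -/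

/-- The matrix whose rows are the vectors of a frame. -/
def Frame.toMatrix {c n : ℕ} (v : Frame c n) : Matrix (Fin c) (Fin n) ℝ :=
  Matrix.of fun i j => v.1 i j

theorem plucker_eq_det {c n : ℕ} (v : Frame c n) (I : Subsets c n) :
    plucker v I = (v.toMatrix.submatrix id (I.1.orderEmbOfFin I.2)).det := rfl

theorem Frame.sum_smul_apply {c n : ℕ} (v : Frame c n) (a : Fin c → ℝ) (i : Fin n) :
    (∑ j, a j • v.1 j) i = Matrix.vecMul a v.toMatrix i := by
  simp [Matrix.vecMul, dotProduct, Frame.toMatrix]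

theorem Frame.eq_zero_of_vecMul_eq_zero {c n : ℕ} (v : Frame c n) {a : Fin c → ℝ}
    (h : Matrix.vecMul a v.toMatrix = 0) : a = 0 := by
  funext j
  refine Fintype.linearIndependent_iff.1 v.2 a ?_ j
  ext i
  rw [v.sum_smul_apply, h]
  rfl

theorem Frame.mem_span_iff {c n : ℕ} (v : Frame c n) {p : EuclideanSpace ℝ (Fin n)} :
    p ∈ v.toGrassmannian.space ↔ ∃ a, ∀ i, p i = Matrix.vecMul a v.toMatrix i := by
  rw [Frame.toGrassmannian, Submodule.mem_span_range_iff_exists_fun]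
  refine exists_congr fun a => ⟨?_, fun h => ?_⟩
  · rintro rfl i
    exact v.sum_smul_apply a i
  · ext i
    rw [v.sum_smul_apply, h]

/-- Frames of the same subspace have proportional Plücker coordinates. -/
theorem exists_plucker_eq_mul {c n : ℕ} {v w : Frame c n}
    (h : v.toGrassmannian = w.toGrassmannian) : ∃ r : ℝ, ∀ I, plucker w I = r * plucker v I := by
  have hw : ∀ i, ∃ a, ∀ j, w.1 i j = Matrix.vecMul a v.toMatrix j := fun i => by
    rw [← v.mem_span_iff, h]
    exact Submodule.subset_span ⟨i, rfl⟩
  choose G hG using hw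
  refine ⟨(Matrix.of G).det, fun I => ?_⟩
  rw [plucker_eq_det, plucker_eq_det, ← Matrix.det_mul]
  congr 1
  ext i j
  exact hG i _

theorem continuous_plucker {c n : ℕ} (I : Subsets c n) :
    Continuous fun v : Frame c n => plucker v I := by
  refine Continuous.matrix_det (continuous_pi fun i => continuous_pi fun j => ?_)
  exact (EuclideanSpace.proj (𝕜 := ℝ) (I.1.orderEmbOfFin I.2 j)).continuous.comp
    ((continuous_apply i).comp continuous_subtype_val)

theorem exists_plucker_ne_zero {c n : ℕ} (v : Frame c n) : ∃ I, plucker v I ≠ 0 := by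
  by_contra! h
  have hdet : (v.toMatrix * v.toMatrix.transpose).det = 0 := by
    rw [det_mul_eq_sum_minors]
    refine Finset.sum_eq_zero fun I _ => ?_
    rw [← plucker_eq_det, h I, zero_mul]
  obtain ⟨a, ha, h0⟩ := Matrix.exists_vecMul_eq_zero_iff.2 hdet
  refine ha (v.eq_zero_of_vecMul_eq_zero ?_)
  rw [← dotProduct_self_eq_zero, ← Matrix.mulVec_transpose, Matrix.dotProduct_mulVec,
    Matrix.mulVec_transpose, Matrix.vecMul_vecMul, h0, zero_dotProduct]

/-- The Plücker coordinates of a point in the closure of an orthant agree weakly in sign with those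
of every point of the orthant, up to a common sign. -/
theorem exists_frame_of_mem_closure_orthant {c n : ℕ} {σ : Subsets c n → ℤˣ}
    {N : Grassmannian c n} (hN : N ∈ closure (orthant σ)) :
    ∃ w : Frame c n, w.toGrassmannian = N ∧
      ((∀ I, 0 ≤ ((σ I : ℤ) : ℝ) * plucker w I) ∨ (∀ I, ((σ I : ℤ) : ℝ) * plucker w I ≤ 0)) := by
  let Z : Set (Grassmannian c n) := {N | ∃ w : Frame c n, w.toGrassmannian = N ∧
      ((∀ I, 0 ≤ ((σ I : ℤ) : ℝ) * plucker w I) ∨ (∀ I, ((σ I : ℤ) : ℝ) * plucker w I ≤ 0))}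
  have hpre : Frame.toGrassmannian ⁻¹' Z = {w : Frame c n |
      (∀ I, 0 ≤ ((σ I : ℤ) : ℝ) * plucker w I) ∨ (∀ I, ((σ I : ℤ) : ℝ) * plucker w I ≤ 0)} := by
    ext w
    refine ⟨?_, fun h => ⟨w, rfl, h⟩⟩
    rintro ⟨v, hv, h⟩
    obtain ⟨r, hr⟩ := exists_plucker_eq_mul hv
    have hr' : ∀ I, ((σ I : ℤ) : ℝ) * plucker w I = r * (((σ I : ℤ) : ℝ) * plucker v I) :=
      fun I => by rw [hr]; ring
    simp only [Set.mem_ofPred_eq, hr']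
    rcases le_total 0 r with h0 | h0
    · exact h.imp (fun h I => mul_nonneg h0 (h I)) fun h I => mul_nonpos_of_nonneg_of_nonpos h0 (h I)
    · exact h.symm.imp (fun h I => mul_nonneg_of_nonpos_of_nonpos h0 (h I)) fun h I =>
        mul_nonpos_of_nonpos_of_nonneg h0 (h I)
  have hclosed : IsClosed Z := by
    rw [isClosed_coinduced, hpre]
    have : {w : Frame c n | (∀ I, 0 ≤ ((σ I : ℤ) : ℝ) * plucker w I) ∨
        (∀ I, ((σ I : ℤ) : ℝ) * plucker w I ≤ 0)} =
        (⋂ I, {w | 0 ≤ ((σ I : ℤ) : ℝ) * plucker w I}) ∪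
          ⋂ I, {w | ((σ I : ℤ) : ℝ) * plucker w I ≤ 0} := by
      ext w
      simp
    rw [this]
    exact (isClosed_iInter fun I => isClosed_le continuous_const
      (continuous_const.mul (continuous_plucker I))).union
      (isClosed_iInter fun I => isClosed_le (continuous_const.mul (continuous_plucker I))
        continuous_const)
  refine closure_minimal ?_ hclosed hN
  rintro _ ⟨v, rfl, h⟩
  exact ⟨v, rfl, h.imp (fun h I => (h I).le) fun h I => (h I).le⟩

/-! ### Sign-transversality in an orthant -/

/-- By the Cauchy–Binet formula the determinant is a sum of terms of one sign, not all zero. -/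
theorem det_mul_diagonal_mul_transpose_ne_zero {c n : ℕ} {v w : Frame c n}
    (hv : ∀ I, plucker v I ≠ 0)
    (hvw : (∀ I, 0 ≤ plucker v I * plucker w I) ∨ (∀ I, plucker v I * plucker w I ≤ 0))
    {δ : Fin n → ℝ} (hδ : ∀ i, 0 < δ i) :
    (v.toMatrix * (Matrix.diagonal δ * w.toMatrix.transpose)).det ≠ 0 := by
  have hminor : ∀ I : Subsets c n,
      ((Matrix.diagonal δ * w.toMatrix.transpose).submatrix (I.1.orderEmbOfFin I.2) id).det =
        (∏ j, δ (I.1.orderEmbOfFin I.2 j)) * plucker w I := fun I => by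
    rw [plucker_eq_det, ← Matrix.det_transpose (w.toMatrix.submatrix _ _), ← Matrix.det_mul_column]
    congr 1
    ext i j
    simp [Matrix.diagonal_mul]
  have hpos : ∀ I : Subsets c n, 0 < ∏ j, δ (I.1.orderEmbOfFin I.2 j) := fun I =>
    Finset.prod_pos fun j _ => hδ _
  rw [det_mul_eq_sum_minors]
  simp only [hminor, ← plucker_eq_det]
  intro hsum
  obtain ⟨I, hI⟩ := exists_plucker_ne_zero w
  have hne : plucker v I * ((∏ j, δ (I.1.orderEmbOfFin I.2 j)) * plucker w I) ≠ 0 :=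
    mul_ne_zero (hv I) (mul_ne_zero (hpos I).ne' hI)
  rcases hvw with h | h
  · refine hne ((Finset.sum_eq_zero_iff_of_nonneg fun J _ => ?_).1 hsum I (Finset.mem_univ I))
    rw [mul_left_comm]
    exact mul_nonneg (hpos J).le (h J)
  · refine hne ((Finset.sum_eq_zero_iff_of_nonpos fun J _ => ?_).1 hsum I (Finset.mem_univ I))
    rw [mul_left_comm]
    exact mul_nonpos_of_nonneg_of_nonpos (hpos J).le (h J)

/-- If no Plücker coordinate of `M` vanishes and `p ∈ M` is nonzero, then `M` contains vectors with
arbitrary prescribed coordinates on the zero set of `p`. -/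
theorem exists_mem_eq_on_zeros {c n : ℕ} {v : Frame c n} (hv : ∀ I, plucker v I ≠ 0)
    {p : EuclideanSpace ℝ (Fin n)} (hp : p ∈ v.toGrassmannian.space) (hp0 : p ≠ 0)
    (x : Fin n → ℝ) : ∃ m ∈ v.toGrassmannian.space, ∀ i, p i = 0 → m i = x i := by
  classical
  have hcn : c ≤ n := by simpa using v.2.fintype_card_le_finrank
  set Z : Finset (Fin n) := Finset.univ.filter fun i => p i = 0 with hZ
  have hunit : ∀ I : Subsets c n,
      IsUnit (v.toMatrix.submatrix id (I.1.orderEmbOfFin I.2)).det := fun I =>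
    (hv I).isUnit
  have hZc : Z.card ≤ c := by
    by_contra! hlt
    obtain ⟨I, hIZ, hI⟩ := Finset.exists_subset_card_eq hlt.le
    obtain ⟨a, ha⟩ := v.mem_span_iff.1 hp
    have ha0 : a = 0 := by
      refine Matrix.eq_zero_of_vecMul_eq_zero (hv ⟨I, hI⟩) (funext fun j => ?_)
      have hj : p (I.orderEmbOfFin hI j) = 0 := by
        simpa [hZ] using hIZ (Finset.orderEmbOfFin_mem I hI j)
      exact (ha _).symm.trans hj
    refine hp0 ?_
    ext i
    rw [ha, ha0, Matrix.zero_vecMul]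
    rfl
  obtain ⟨I, hZI, -, hI⟩ := Finset.exists_subsuperset_card_eq (Finset.subset_univ Z) hZc
    (by simpa using hcn)
  set A := v.toMatrix.submatrix id (I.orderEmbOfFin hI) with hA
  set a := Matrix.vecMul (fun j => x (I.orderEmbOfFin hI j)) A⁻¹ with ha
  have haA : Matrix.vecMul a A = fun j => x (I.orderEmbOfFin hI j) := by
    rw [ha, Matrix.vecMul_vecMul, Matrix.nonsing_inv_mul _ (hunit ⟨I, hI⟩), Matrix.vecMul_one]
  refine ⟨WithLp.toLp 2 (Matrix.vecMul a v.toMatrix), v.mem_span_iff.2 ⟨a, fun i => rfl⟩,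
    fun i hi => ?_⟩
  have : i ∈ Set.range (I.orderEmbOfFin hI) := by
    rw [Finset.range_orderEmbOfFin]
    exact hZI (by simpa [hZ] using hi)
  obtain ⟨j, rfl⟩ := this
  exact congrFun haA j

/-- A violating pair `p`, `x` could be perturbed: replacing `p` by `p + ε m`, where `m ∈ M` equals
`x` on the zeros of `p`, makes `x` a positive diagonal scaling of a vector of `M`. As `x` is
orthogonal to `N`, this contradicts the nonvanishing of a determinant. -/
theorem signTransversal_of_plucker {c n : ℕ} {v w : Frame c n}
    {L : Submodule ℝ (EuclideanSpace ℝ (Fin n))}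
    (hv : ∀ I, plucker v I ≠ 0)
    (hvw : (∀ I, 0 ≤ plucker v I * plucker w I) ∨ (∀ I, plucker v I * plucker w I ≤ 0))
    (hw : w.toGrassmannian.space = Lᗮ) :
    SignTransversal v.toGrassmannian.space L := by
  intro p hp x hx hpx
  by_contra hp0
  obtain ⟨m, hm, hmx⟩ := exists_mem_eq_on_zeros hv hp hp0 fun i => x i
  obtain ⟨ε, hε, hεpos⟩ : ∃ ε : ℝ, (∀ i, p i ≠ 0 → 0 < x i * (p i + ε * m i)) ∧ 0 < ε := by
    have h1 : ∀ᶠ ε : ℝ in nhdsWithin 0 (Set.Ioi 0), ∀ i, p i ≠ 0 → 0 < x i * (p i + ε * m i) := by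
      rw [Filter.eventually_all]
      intro i
      by_cases hi : p i = 0
      · exact Filter.Eventually.of_forall fun _ h => absurd hi h
      · have hc : Continuous fun ε : ℝ => x i * (p i + ε * m i) := by fun_prop
        have hlt : 0 < x i * (p i + 0 * m i) := by simpa using hpx i hi
        exact (hc.continuousAt.eventually_const_lt hlt).filter_mono nhdsWithin_le_nhds |>.mono
          fun _ h _ => h
    exact (h1.and self_mem_nhdsWithin).exists
  set q := p + ε • m with hq
  have hqi : ∀ i, q i = p i + ε * m i := fun i => rfl
  obtain ⟨a, ha⟩ := v.mem_span_iff.1 (Submodule.add_mem _ hp (Submodule.smul_mem _ ε hm))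
  have ha : ∀ i, q i = Matrix.vecMul a v.toMatrix i := ha
  let δ : Fin n → ℝ := fun i => if q i = 0 then 1 else x i / q i
  have hsign : ∀ i, q i = 0 ∧ x i = 0 ∨ 0 < x i * q i := fun i => by
    by_cases hi : p i = 0
    · rw [hqi, hi, hmx i hi, zero_add]
      rcases eq_or_ne (x i) 0 with h0 | h0
      · left
        simp [h0]
      · right
        rw [mul_left_comm]
        exact mul_pos hεpos (mul_self_pos.2 h0)
    · exact Or.inr (hε i hi)
  have hδ : ∀ i, 0 < δ i := fun i => by
    rcases hsign i with h | h
    · simp [δ, h.1]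
    · have hqi0 : q i ≠ 0 := fun h0 => by simp [h0] at h
      simp only [δ, hqi0, if_false]
      rw [← mul_div_mul_right _ _ hqi0]
      exact div_pos h (mul_self_pos.2 hqi0)
  have hδx : ∀ i, q i * δ i = x i := fun i => by
    rcases hsign i with h | h
    · simp [h.1, h.2]
    · have hqi0 : q i ≠ 0 := fun h0 => by simp [h0] at h
      simp only [δ, hqi0, if_false]
      field_simp
  have hzero : Matrix.vecMul a (v.toMatrix * (Matrix.diagonal δ * w.toMatrix.transpose)) = 0 := by
    rw [← Matrix.vecMul_vecMul, ← Matrix.vecMul_vecMul]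
    funext k
    have hk : w.1 k ∈ Lᗮ := by
      rw [← hw]
      exact Submodule.subset_span ⟨k, rfl⟩
    have h0 : ∑ i, x i * w.1 k i = 0 := by
      have := (Submodule.mem_orthogonal L _).1 hk x hx
      simpa [PiLp.inner_apply, mul_comm] using this
    refine (Finset.sum_congr rfl fun i _ => ?_).trans h0
    rw [Matrix.vecMul_diagonal, ← ha i, hδx i]
    rfl
  have ha0 : a = 0 := by
    by_contra hne
    exact det_mul_diagonal_mul_transpose_ne_zero hv hvw hδ
      (Matrix.exists_vecMul_eq_zero_iff.1 ⟨a, hne, hzero⟩)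
  refine hp0 ?_
  ext i
  by_contra hi
  have := hε i hi
  rw [← hqi, ha, ha0, Matrix.zero_vecMul] at this
  simp at this

theorem signTransversal_of_mem_orthant {d n : ℕ} {L : Grassmannian d n}
    {σ : Subsets (n - d) n → ℤˣ} (hL : L.perp ∈ closure (orthant σ))
    {M : Grassmannian (n - d) n} (hM : M ∈ orthant σ) : SignTransversal M.space L.space := by
  obtain ⟨w, hw, hws⟩ := exists_frame_of_mem_closure_orthant hL
  obtain ⟨v, rfl, hvs⟩ := hM
  have hprod : ∀ I, plucker v I * plucker w I =
      (((σ I : ℤ) : ℝ) * plucker v I) * (((σ I : ℤ) : ℝ) * plucker w I) := fun I => by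
    rcases Int.units_eq_one_or (σ I) with h | h <;> simp [h]
  refine signTransversal_of_plucker (w := w) (fun I h0 => ?_) ?_ (by rw [hw]; rfl)
  · rcases hvs with h | h <;> simpa [h0] using h I
  · simp only [hprod]
    rcases hvs with h | h <;> rcases hws with h' | h'
    · exact Or.inl fun I => mul_nonneg (h I).le (h' I)
    · exact Or.inr fun I => mul_nonpos_of_nonneg_of_nonpos (h I).le (h' I)
    · exact Or.inr fun I => mul_nonpos_of_nonpos_of_nonneg (h I).le (h' I)
    · exact Or.inl fun I => mul_nonneg_of_nonpos_of_nonpos (h I).le (h' I)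

end ReciprocalLinear

theorem corollary2p5 (n d : ℕ) (L : ReciprocalLinear.Grassmannian d n)
    (hL : ∀ i : Fin n, ∃ x ∈ L.space, x i ≠ 0) :
    ReciprocalLinear.IsHyperbolic (ReciprocalLinear.reciprocal L.space) L.perp.space ∧
    ∀ σ : ReciprocalLinear.Subsets (n - d) n → ℤˣ,
      L.perp ∈ closure (ReciprocalLinear.orthant σ) →
        ReciprocalLinear.IsStable (ReciprocalLinear.reciprocal L.space) σ := by
  have hvar : ReciprocalLinear.IsRealVariety (ReciprocalLinear.reciprocal L.space) (n - d) := by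
    refine ReciprocalLinear.isRealVariety_reciprocal ?_ hL
    have h := L.space.finrank_le
    rw [finrank_euclideanSpace_fin, L.finrank_eq] at h
    rw [L.finrank_eq]
    omega
  have hrank : Module.finrank ℝ (L.space)ᗮ = n - d := L.perp.finrank_eq
  refine ⟨(ReciprocalLinear.signTransversal_orthogonal L.space).isHyperbolic
    (by rw [hrank]; exact hvar), fun σ hσ => ⟨hvar, fun M hM => ?_⟩⟩
  exact (ReciprocalLinear.signTransversal_of_mem_orthant hσ hM).isHyperbolic
    (by rw [M.finrank_eq]; exact hvar)
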